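/- For a group $G$ and $S\subseteq G$ let $C_G(S)=\{g\in G : gs=sg \text{ for all } s\in S\}$; the subgroups of this form are the centralisers of $G$. A centraliser chain of length $n$ in $G$ is a strictly descending chain $C_0>C_1>\cdots>C_n$ of centralisers of $G$. The centraliser dimension $\mathrm{cdim}(G)$ is the greatest length of a centraliser chain in $G$, and $\mathrm{cdim}(G)=\infty$ if there is no greatest length. Let $Z(G)$ be the centre of $G$, and put $z(G)=0$ if $Z(G)=1$ and $z(G)=2$ otherwise. Let $G_1$ and $G_2$ be groups of finite centraliser dimension. Then: 1. if $H\le G_2$ is a subgroup, then $\mathrm{cdim}(H)\le \mathrm{cdim}(G_2)$; 2. $\mathrm{cdim}(G_1\times G_2)=\mathrm{cdim}(G_1)+\mathrm{cdim}(G_2)$; 3. if $G_1$ and $G_2$ are both non-trivial, then the free product satisfies $\mathrm{cdim}(G_1 * G_2)=\max\{\mathrm{cdim}(G_1)+z(G_1),\ \mathrm{cdim}(G_2)+z(G_2)\}$; 4. if $G_1$ and $G_2$ are non-Abelian, $Z(G_1)\neq 1$, and $\varphi\colon Z(G_1)\to Z(G_2)$ is an isomorphism, then the amalgamated free product $G=G_1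 *_{Z(G_1)=Z(G_2)} G_2$, in which each $a\in Z(G_1)$ is identified with $\varphi(a)$, satisfies $\mathrm{cdim}(G)=\max\{\mathrm{cdim}(G_1),\mathrm{cdim}(G_2)\}$. -/

import Mathlib

/-- `C` is the centraliser in `G` of some subset of `G`. -/
def IsCentraliser {G : Type*} [Group G] (C : Subgroup G) : Prop :=
  ∃ S : Set G, C = Subgroup.centralizer S

/-- `G` has a centraliser chain `C₀ > C₁ > ⋯ > Cₙ` of length `n`. -/
def HasCentraliserChain (G : Type*) [Group G] (n : ℕ) : Prop :=
  ∃ C : Fin (n + 1) → Subgroup G, StrictAnti C ∧ ∀ i, IsCentraliser (C i)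

/-- The centraliser dimension: the greatest length of a centraliser chain of `G`, and `⊤` if
there is no greatest length (there is always the chain `G` of length `0`). -/
noncomputable def cdim (G : Type*) [Group G] : ℕ∞ :=
  ⨆ (n : ℕ) (_ : HasCentraliserChain G n), (n : ℕ∞)

open Classical in
/-- `z(G) = 0` if the centre of `G` is trivial, and `z(G) = 2` otherwise. -/
noncomputable def zOf (G : Type*) [Group G] : ℕ∞ :=
  if Subgroup.center G = ⊥ then 0 else 2

/-- The normal subgroup of the free product `G₁ * G₂` generated by the elements `a * φ(a)⁻¹`,
`a ∈ A`. -/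
def amalgamRelations {G₁ G₂ : Type*} [Group G₁] [Group G₂] {A : Subgroup G₁} {B : Subgroup G₂}
    (φ : A ≃* B) : Subgroup (Monoid.Coprod G₁ G₂) :=
  Subgroup.normalClosure
    (Set.range fun a : A =>
      (Monoid.Coprod.inl (a : G₁) * (Monoid.Coprod.inr (φ a : G₂))⁻¹ : Monoid.Coprod G₁ G₂))

instance amalgamRelations_normal {G₁ G₂ : Type*} [Group G₁] [Group G₂] {A : Subgroup G₁}
    {B : Subgroup G₂} (φ : A ≃* B) : (amalgamRelations φ).Normal :=
  Subgroup.normalClosure_normal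

/-- The amalgamated free product of `G₁` and `G₂` in which `A ≤ G₁` is identified with
`B ≤ G₂` along the isomorphism `φ`. -/
abbrev AmalgamatedProduct {G₁ G₂ : Type*} [Group G₁] [Group G₂] {A : Subgroup G₁}
    {B : Subgroup G₂} (φ : A ≃* B) : Type _ :=
  Monoid.Coprod G₁ G₂ ⧸ amalgamRelations φ

/-! For an injective `f : H →* G`, the map `C ↦ C_G(f(C_H(C)))` on centralisers is strictly
monotone, because pulling back along `f` recovers `C`; this gives part 1. Centralisers of a direct
product are exactly the products of centralisers, and lengths of chains add in a product of orders;
this gives part 2.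

In parts 3 and 4, `G` maps onto a free product with kernel exactly `Z(G)`. A nontrivial element of a
free product is either conjugate into a factor, where centralisers of nontrivial elements stay
inside that conjugate, or conjugate to a cyclically reduced word, whose centraliser is cyclic.

For the upper bound (`cdim_le_of_forall_noncentral`), take a chain `C₀ > ⋯ > Cₙ` with `n > 2`, a
noncentral `g` that centralises `C₁` and a noncentral `t` in `Cₙ₋₁`. For `1 ≤ j ≤ n - 1` one has `Cⱼ
≤ C_G(g)` and `C_G(Cⱼ) ≤ C_G(t)`. If the image of `g` has cyclic type, these groups commute with
each other and `C₁ = C₂`, which is absurd. Otherwise they all lie in a conjugate `K` of a factor, so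
`C₁ > ⋯ > Cₙ₋₁` is a chain of length `n - 2` in `K`. If `Z(K) ≤ Z(G)`, adding `K` and `Z(K)` at the
ends restores the length `n`; if not, two steps may be lost. Conversely (`cdim_add_two_le`), when a
factor has a central element that is not central in `G`, its pushed chains lie strictly between
`Z(G)` and `G`, which gains two steps. This is the source of `z`. -/

/-! ### Reduced words and centralisers in free products. -/

namespace Monoid.CoprodI

variable {ι : Type*} {M : ι → Type*} [∀ i, Group (M i)]

open Classical in
/-- The number of letters of the reduced word that represents an element of a free product. -/
noncomputable def norm (x : CoprodI M) : ℕ := (Word.equiv x).toList.length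

theorem norm_word_prod (w : Word M) : norm w.prod = w.toList.length := by
  classical
  have h : Word.equiv w.prod = w := Word.equiv.apply_symm_apply w
  rw [← congrArg (fun v : Word M => v.toList.length) h, norm]

theorem norm_neWord_prod {i j : ι} (w : NeWord M i j) : norm w.prod = w.toList.length :=
  norm_word_prod w.toWord

theorem norm_neWord_pos {i j : ι} (w : NeWord M i j) : 0 < norm w.prod := by
  rw [norm_neWord_prod]
  exact List.length_pos_of_ne_nil w.toList_ne_nil

/-- By uniqueness of reduced forms, equal products come from the same word. -/
theorem fst_eq_of_prod_eq {i j k l : ι} {v : NeWord M i j} {w : NeWord M k l}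
    (h : v.prod = w.prod) : i = k := by
  classical
  have h1 : v.toWord = w.toWord := Word.equiv.symm.injective h
  have h2 := congrArg (fun u : Word M => u.toList.head?) h1
  simp only [NeWord.toWord, NeWord.toList_head?, Option.some.injEq, Sigma.mk.injEq] at h2
  exact h2.1

theorem last_eq_of_prod_eq {i j k l : ι} {v : NeWord M i j} {w : NeWord M k l}
    (h : v.prod = w.prod) : j = l :=
  fst_eq_of_prod_eq (v := v.inv) (w := w.inv) (by rw [NeWord.inv_prod, NeWord.inv_prod, h])

theorem norm_append {i j k l : ι} (v : NeWord M i j) (h : j ≠ k) (w : NeWord M k l) :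
    norm (v.prod * w.prod) = norm v.prod + norm w.prod := by
  rw [← NeWord.append_prod (hne := h)]
  simp only [norm_neWord_prod, NeWord.toList, List.length_append]

theorem norm_of {i : ι} {m : M i} (hm : m ≠ 1) : norm (of m) = 1 := by
  rw [← NeWord.prod_singleton m hm, norm_neWord_prod]
  rfl

theorem exists_word_prod_eq (x : CoprodI M) : ∃ w : Word M, w.prod = x := by
  classical exact ⟨Word.equiv x, Word.equiv.symm_apply_apply x⟩

theorem exists_neWord_prod_eq {x : CoprodI M} (hx : x ≠ 1) :
    ∃ (i j : ι) (w : NeWord M i j), w.prod = x := by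
  obtain ⟨w, rfl⟩ := exists_word_prod_eq x
  obtain ⟨i, j, v, rfl⟩ := NeWord.of_word w (by rintro rfl; exact hx Word.prod_empty)
  exact ⟨i, j, v, rfl⟩

theorem neWord_prod_ne_one {i j : ι} (w : NeWord M i j) : w.prod ≠ 1 := by
  intro h
  have := norm_neWord_pos w
  rw [h, ← Word.prod_empty, norm_word_prod] at this
  simp [Word.empty] at this

theorem norm_inv (x : CoprodI M) : norm x⁻¹ = norm x := by
  by_cases hx : x = 1
  · simp [hx]
  obtain ⟨i, j, w, rfl⟩ := exists_neWord_prod_eq hx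
  rw [← NeWord.inv_prod, norm_neWord_prod, norm_neWord_prod]
  induction w with
  | singleton => rfl
  | append v h w ihv ihw =>
    simp only [NeWord.inv, NeWord.toList, List.length_append,
      ihv (neWord_prod_ne_one v), ihw (neWord_prod_ne_one w), add_comm]

/-- Every element is a letter from `M i` times a reduced word that does not start in `M i`. -/
theorem exists_of_mul_neWord (i : ι) (x : CoprodI M) :
    (∃ m : M i, x = of m) ∨
      ∃ (m : M i) (j k : ι) (w : NeWord M j k), i ≠ j ∧ x = of m * w.prod := by
  classical
  obtain ⟨w, rfl⟩ := exists_word_prod_eq x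
  set p := Word.equivPair i w with hp
  have hw : w.prod = of p.head * p.tail.prod := by
    rw [← Word.prod_rcons, ← Word.equivPair_symm, hp, Equiv.symm_apply_apply]
  by_cases ht : p.tail = Word.empty
  · exact Or.inl ⟨p.head, by rw [hw, ht, Word.prod_empty, mul_one]⟩
  · obtain ⟨j, k, v, hv⟩ := NeWord.of_word p.tail ht
    refine Or.inr ⟨p.head, j, k, v, ?_, by rw [hw, ← hv]; rfl⟩
    rintro rfl
    apply p.fstIdx_ne
    rw [← hv]
    simp [Word.fstIdx, NeWord.toWord]

theorem norm_of_mul_neWord_le {i j k : ι} (m : M i) (w : NeWord M j k) (h : i ≠ j) :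
    norm (of m * w.prod) ≤ norm w.prod + 1 := by
  by_cases hm : m = 1
  · simp [hm]
  · rw [← NeWord.prod_singleton m hm, norm_append _ h, NeWord.prod_singleton, norm_of hm, add_comm]

/-- Multiplying a reduced word by an element of the factor where it starts does not increase its
norm. -/
theorem norm_of_mul_le {i j : ι} (m : M i) (w : NeWord M i j) :
    norm (of m * w.prod) ≤ norm w.prod := by
  rcases exists_of_mul_neWord i w.prod with ⟨n, hn⟩ | ⟨n, k, l, v, hk, hv⟩
  · rw [hn, ← map_mul]
    have hn1 : n ≠ 1 := by rintro rfl; exact neWord_prod_ne_one w (by simp [hn])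
    rw [norm_of hn1]
    by_cases h : m * n = 1
    · rw [h, map_one, ← Word.prod_empty, norm_word_prod]
      simp [Word.empty]
    · rw [norm_of h]
  · have hn1 : n ≠ 1 := by
      rintro rfl
      exact hk (fst_eq_of_prod_eq (v := w) (w := v) (by simpa using hv))
    have h3 : norm (of n * v.prod) = 1 + norm v.prod := by
      rw [← NeWord.prod_singleton n hn1, norm_append _ hk, NeWord.prod_singleton, norm_of hn1]
    rw [hv, ← mul_assoc, ← map_mul, h3, add_comm]
    exact norm_of_mul_neWord_le _ _ hk

theorem norm_mul_of_le {i j : ι} (w : NeWord M i j) (m : M j) :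
    norm (w.prod * of m) ≤ norm w.prod := by
  rw [← norm_inv (w.prod * of m), ← norm_inv w.prod, mul_inv_rev, ← map_inv, ← NeWord.inv_prod]
  exact norm_of_mul_le _ _

/-- Every element of a free product is conjugate to an element of a factor or to a cyclically
reduced word. -/
theorem exists_conj_eq (x : CoprodI M) (hx : x ≠ 1) :
    ∃ y : CoprodI M, (∃ (i : ι) (m : M i), y * x * y⁻¹ = of m) ∨
      ∃ (i j : ι) (w : NeWord M i j), i ≠ j ∧ y * x * y⁻¹ = w.prod := by
  induction hn : norm x using Nat.strong_induction_on generalizing x with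
  | _ n ih =>
  obtain ⟨i, j, w, rfl⟩ := exists_neWord_prod_eq hx
  by_cases hij : i = j
  swap
  · exact ⟨1, Or.inr ⟨i, j, w, hij, by simp⟩⟩
  subst hij
  rcases exists_of_mul_neWord i w.prod with ⟨m, hm⟩ | ⟨m, k, l, v, hk, hv⟩
  · exact ⟨1, Or.inl ⟨i, m, by simp [hm]⟩⟩
  have hm1 : m ≠ 1 := by
    rintro rfl
    exact hk (fst_eq_of_prod_eq (v := w) (w := v) (by simpa using hv))
  have hl : i = l := last_eq_of_prod_eq (v := w)
    (w := NeWord.append (NeWord.singleton m hm1) hk v) (by simp [hv])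
  subst hl
  -- Conjugation moves the first letter to the end, where it is absorbed by the last letter because
  -- both lie in `M i`; the norm drops.
  have hconj : (of m)⁻¹ * w.prod * (of m)⁻¹⁻¹ = v.prod * of m := by rw [hv]; group
  have hlt : norm (v.prod * of m) < n := by
    refine (norm_mul_of_le v m).trans_lt ?_
    rw [← hn, hv, ← NeWord.prod_singleton m hm1, norm_append _ hk, NeWord.prod_singleton,
      norm_of hm1]
    omega
  obtain ⟨y, hy⟩ := ih _ hlt (v.prod * of m)
    (by rw [← hconj]; exact fun h => hx (conj_eq_one_iff.1 h)) rfl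
  refine ⟨y * (of m)⁻¹, ?_⟩
  have : y * (of m)⁻¹ * w.prod * (y * (of m)⁻¹)⁻¹ = y * (v.prod * of m) * y⁻¹ := by
    rw [← hconj]; group
  rwa [this]

/-- The centraliser of a nontrivial element of a factor lies in that factor. -/
theorem mem_range_of_commute {i : ι} {m : M i} (hm : m ≠ 1) {x : CoprodI M}
    (h : Commute x (of m)) : ∃ n : M i, x = of n := by
  rcases exists_of_mul_neWord i x with hx | ⟨n, j, k, w, hj, rfl⟩
  · exact hx
  exfalso
  have hc : n⁻¹ * m * n ≠ 1 := by
    intro h'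
    apply hm
    have : n⁻¹ * m * n⁻¹⁻¹ = 1 := by simpa using h'
    exact conj_eq_one_iff.1 this
  -- With `x = n w`, commutation reads `w⁻¹ (n⁻¹ m n) w = m`. The left side is reduced of norm `2|w|
  -- + 1`, the right side has norm `1`.
  have key : w.inv.prod * ((NeWord.singleton (n⁻¹ * m * n) hc).append hj w).prod = of m := by
    have h' : of n * w.prod * of m = of m * (of n * w.prod) := h
    rw [NeWord.append_prod, NeWord.prod_singleton, NeWord.inv_prod, map_mul, map_mul, map_inv]
    calc w.prod⁻¹ * ((of n)⁻¹ * of m * of n * w.prod)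
        = w.prod⁻¹ * (of n)⁻¹ * (of m * (of n * w.prod)) := by group
      _ = of m := by rw [← h']; group
  have h1 := norm_append w.inv hj.symm ((NeWord.singleton (n⁻¹ * m * n) hc).append hj w)
  rw [key, norm_of hm, NeWord.append_prod, norm_append _ hj, NeWord.prod_singleton,
    norm_of hc] at h1
  have := norm_neWord_pos w
  omega

/-- If `x` neither starts nor ends in `M j`, then `g x g⁻¹` is reduced and longer than `x`, although
it equals `x`; with `g⁻¹ x g` the same holds for `M i`. So the two ends of `x` are `i` and `j` in
some order. -/
theorem commute_neWord_type {i j k l : ι} (hij : i ≠ j) (g : NeWord M i j) (x : NeWord M k l)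
    (h : Commute x.prod g.prod) : (k = i ∧ l = j) ∨ (k = j ∧ l = i) := by
  have h' : x.prod * g.prod = g.prod * x.prod := h
  have hg := norm_neWord_pos g
  have h1 : k = j ∨ l = j := by
    by_contra! hne
    have e1 := norm_append g hne.1.symm (x.append hne.2 g.inv)
    have e2 := norm_append x hne.2 g.inv
    have e3 : g.prod * (x.append hne.2 g.inv).prod = x.prod := by
      rw [NeWord.append_prod, NeWord.inv_prod, ← mul_assoc, ← h', mul_inv_cancel_right]
    rw [e3, NeWord.append_prod, e2] at e1
    omega
  have h2 : k = i ∨ l = i := by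
    by_contra! hne
    have e1 := norm_append g.inv hne.1.symm (x.append hne.2 g)
    have e2 := norm_append x hne.2 g
    have e3 : g.inv.prod * (x.append hne.2 g).prod = x.prod := by
      rw [NeWord.append_prod, NeWord.inv_prod, h', inv_mul_cancel_left]
    rw [e3, NeWord.append_prod, e2, NeWord.inv_prod, norm_inv] at e1
    omega
  grind

/-- An element that commutes with a cyclically reduced word is trivial, or a word of the same type,
or the inverse of such a word. -/
theorem commute_neWord_cases {i j : ι} (hij : i ≠ j) (g : NeWord M i j) {x : CoprodI M}
    (h : Commute x g.prod) :
    x = 1 ∨ (∃ w : NeWord M i j, x = w.prod) ∨ ∃ w : NeWord M i j, x = w.prod⁻¹ := by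
  by_cases hx : x = 1
  · exact Or.inl hx
  obtain ⟨k, l, w, rfl⟩ := exists_neWord_prod_eq hx
  rcases commute_neWord_type hij g w h with ⟨rfl, rfl⟩ | ⟨rfl, rfl⟩
  · exact Or.inr (Or.inl ⟨w, rfl⟩)
  · exact Or.inr (Or.inr ⟨w.inv, by rw [NeWord.inv_prod, inv_inv]⟩)

/-- The centraliser of a cyclically reduced word is cyclic. -/
theorem exists_centralizer_le_zpowers {i j : ι} (hij : i ≠ j) (g : NeWord M i j) :
    ∃ c : CoprodI M, ∀ x, Commute x g.prod → x ∈ Subgroup.zpowers c := by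
  classical
  have hex : ∃ n, ∃ w : NeWord M i j, Commute w.prod g.prod ∧ norm w.prod = n :=
    ⟨_, g, Commute.refl _, rfl⟩
  -- The generator is a shortest word of type `i, j` that commutes with `g`; other such words are
  -- reduced by Euclidean division by `c`.
  obtain ⟨c, hcg, hcn⟩ := Nat.find_spec hex
  have hmin : ∀ w : NeWord M i j, Commute w.prod g.prod → norm c.prod ≤ norm w.prod := by
    intro w hw
    rw [hcn]
    exact Nat.find_min' hex ⟨w, hw, rfl⟩
  have key : ∀ n, ∀ w : NeWord M i j, Commute w.prod g.prod → norm w.prod = n →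
      w.prod ∈ Subgroup.zpowers c.prod := by
    intro n
    induction n using Nat.strong_induction_on with
    | _ n ih =>
    intro w hw hn
    have hq : Commute (c.prod⁻¹ * w.prod) g.prod := hcg.inv_left.mul_left hw
    have hmul : w.prod = c.prod * (c.prod⁻¹ * w.prod) := by group
    rcases commute_neWord_cases hij g hq with h1 | ⟨v, hv⟩ | ⟨v, hv⟩
    · rw [hmul, h1, mul_one]
      exact Subgroup.mem_zpowers _
    · rw [hv] at hmul hq
      have := norm_append c hij.symm v
      rw [← hmul] at this
      have hc := norm_neWord_pos c
      rw [hmul]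
      exact Subgroup.mul_mem _ (Subgroup.mem_zpowers _) (ih _ (by omega) v hq rfl)
    -- Here `c = w v` without cancellation, so `w` would be shorter than `c`.
    · exfalso
      have hc : c.prod = w.prod * v.prod := by
        have : v.prod = w.prod⁻¹ * c.prod := by rw [← inv_inv v.prod, ← hv]; group
        rw [this]; group
      have h1 := norm_append w hij.symm v
      rw [← hc] at h1
      have h2 := norm_neWord_pos v
      have h3 := hmin w hw
      omega
  refine ⟨c.prod, fun x hx => ?_⟩
  rcases commute_neWord_cases hij g hx with rfl | ⟨v, rfl⟩ | ⟨v, rfl⟩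
  · exact Subgroup.one_mem _
  · exact key _ v hx rfl
  · exact Subgroup.inv_mem _ (key _ v (by simpa using hx.inv_left) rfl)

/-- Up to inversion `t` is itself a cyclically reduced word, so its centraliser is cyclic; it
contains both `u` and `g`. -/
theorem commute_of_commute_neWord {i j : ι} (hij : i ≠ j) (g : NeWord M i j) {t u : CoprodI M}
    (ht : t ≠ 1) (htg : Commute t g.prod) (hut : Commute u t) : Commute u g.prod := by
  obtain ⟨v, hut, htg⟩ : ∃ v : NeWord M i j, Commute u v.prod ∧ Commute v.prod g.prod := by
    rcases commute_neWord_cases hij g htg with h | ⟨v, rfl⟩ | ⟨v, rfl⟩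
    · exact absurd h ht
    · exact ⟨v, hut, htg⟩
    · exact ⟨v, by simpa using hut.inv_right, by simpa using htg.inv_left⟩
  obtain ⟨c, hc⟩ := exists_centralizer_le_zpowers hij v
  obtain ⟨a, rfl⟩ := Subgroup.mem_zpowers_iff.1 (hc _ hut)
  obtain ⟨b, hb⟩ := Subgroup.mem_zpowers_iff.1 (hc _ htg.symm)
  rw [← hb]
  exact (Commute.refl c).zpow_zpow a b

/-- An element of a free product is conjugate into a factor, or it has a cyclic centraliser that
is the centraliser of each of its nontrivial elements. -/
theorem conj_of_or_cyclic_centralizer (x : CoprodI M) (hx : x ≠ 1) :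
    (∃ (y : CoprodI M) (i : ι) (m : M i), y * x * y⁻¹ = of m) ∨
      ∃ c : CoprodI M, ∀ t, t ≠ 1 → Commute t x → ∀ u, Commute u t →
        u ∈ Subgroup.zpowers c := by
  obtain ⟨y, ⟨i, m, h⟩ | ⟨i, j, g, hij, h⟩⟩ := exists_conj_eq x hx
  · exact Or.inl ⟨y, i, m, h⟩
  refine Or.inr ?_
  obtain ⟨c, hc⟩ := exists_centralizer_le_zpowers hij g
  have hconj : ∀ {a b : CoprodI M}, Commute a b → Commute (y * a * y⁻¹) (y * b * y⁻¹) :=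
    fun hab => by simpa using hab.map (MulAut.conj y).toMonoidHom
  refine ⟨y⁻¹ * c * y, fun t ht htx u hut => ?_⟩
  obtain ⟨n, hn⟩ := Subgroup.mem_zpowers_iff.1 (hc _ (commute_of_commute_neWord hij g
    (fun h' => ht (conj_eq_one_iff.1 h')) (h ▸ hconj htx) (hconj hut)))
  refine Subgroup.mem_zpowers_iff.2 ⟨n, ?_⟩
  have h1 : (y⁻¹ * c * y) ^ n = y⁻¹ * c ^ n * y := by
    simpa using conj_zpow (a := y⁻¹) (b := c) (i := n)
  rw [h1, hn]
  group

theorem of_ne_of {i j : ι} (hij : i ≠ j) {m : M i} (hm : m ≠ 1) (n : M j) :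
    (of m : CoprodI M) ≠ of n := by
  intro h
  by_cases hn : n = 1
  · exact hm (of_injective i (by rw [h, hn, map_one, map_one]))
  refine neWord_prod_ne_one ((NeWord.singleton m hm).append hij
    (NeWord.singleton n⁻¹ (inv_ne_one.2 hn))) ?_
  simp [h]

/-- A free product with two nontrivial factors has trivial centre. -/
theorem eq_one_of_forall_commute {i j : ι} (hij : i ≠ j) [Nontrivial (M i)] [Nontrivial (M j)]
    {x : CoprodI M} (hx : ∀ y, Commute x y) : x = 1 := by
  obtain ⟨a, ha⟩ := exists_ne (1 : M i)
  obtain ⟨b, hb⟩ := exists_ne (1 : M j)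
  obtain ⟨m, hm⟩ := mem_range_of_commute ha (hx _)
  obtain ⟨n, hn⟩ := mem_range_of_commute hb (hx _)
  by_contra hne
  exact of_ne_of hij (m := m) (by rintro rfl; exact hne (by simp [hm])) n (hm ▸ hn)

end Monoid.CoprodI

/-! ### Centralisers, chains and Krull dimension. -/

theorem IsCentraliser.centralizer_centralizer {G : Type*} [Group G] {C : Subgroup G}
    (h : IsCentraliser C) :
    Subgroup.centralizer (Subgroup.centralizer (C : Set G) : Set G) = C := by
  obtain ⟨S, rfl⟩ := h
  exact SetLike.coe_injective (Set.centralizer_centralizer_centralizer S)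

theorem isCentraliser_centralizer {G : Type*} [Group G] (S : Set G) :
    IsCentraliser (Subgroup.centralizer S) := ⟨S, rfl⟩

theorem isCentraliser_top {G : Type*} [Group G] : IsCentraliser (⊤ : Subgroup G) :=
  ⟨∅, by ext; simp [Subgroup.mem_centralizer_iff]⟩

theorem isCentraliser_center {G : Type*} [Group G] : IsCentraliser (Subgroup.center G) :=
  ⟨Set.univ, Subgroup.centralizer_univ.symm⟩

theorem IsCentraliser.center_le {G : Type*} [Group G] {C : Subgroup G} (h : IsCentraliser C) :
    Subgroup.center G ≤ C := by
  obtain ⟨S, rfl⟩ := h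
  exact Subgroup.center_le_centralizer S

/-- A centraliser chain indexed by an initial segment of the natural numbers. -/
theorem hasCentraliserChain_iff {G : Type*} [Group G] {n : ℕ} :
    HasCentraliserChain G n ↔
      ∃ C : ℕ → Subgroup G, (∀ i < n, C (i + 1) < C i) ∧ ∀ i ≤ n, IsCentraliser (C i) := by
  constructor
  · rintro ⟨C, hC, h⟩
    refine ⟨fun i => C ⟨min i n, by omega⟩, fun i hi => hC ?_, fun i _ => h _⟩
    rw [Fin.mk_lt_mk]
    omega
  · rintro ⟨C, hC, h⟩
    refine ⟨fun i => C i, Fin.strictAnti_iff_succ_lt.2 fun i => ?_, fun i => h _ (by omega)⟩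
    exact hC i i.2

/-- The centralisers of a group, ordered by inclusion. -/
abbrev Centralisers (G : Type*) [Group G] : Type _ := {C : Subgroup G // IsCentraliser C}

instance Centralisers.nonempty (G : Type*) [Group G] : Nonempty (Centralisers G) :=
  ⟨⟨⊤, isCentraliser_top⟩⟩

theorem hasCentraliserChain_iff_exists_ltSeries {G : Type*} [Group G] {n : ℕ} :
    HasCentraliserChain G n ↔ ∃ p : LTSeries (Centralisers G), p.length = n := by
  constructor
  · rintro ⟨C, hC, h⟩
    refine ⟨LTSeries.mk n (fun i => ⟨C i.rev, h _⟩) fun i j hij => ?_, rfl⟩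
    exact hC (Fin.rev_lt_rev.2 hij)
  · rintro ⟨p, rfl⟩
    refine ⟨fun i => (p i.rev).1, fun i j hij => ?_, fun i => (p i.rev).2⟩
    exact p.strictMono (Fin.rev_lt_rev.2 hij)

/-- Makes order theory available: strictly monotone maps, order isomorphisms and adjoined end points
translate directly into statements on `cdim`. -/
theorem coe_cdim (G : Type*) [Group G] :
    (cdim G : WithBot ℕ∞) = Order.krullDim (Centralisers G) := by
  rw [Order.krullDim_eq_iSup_length, WithBot.coe_inj, cdim]
  apply le_antisymm
  · refine iSup₂_le fun n hn => ?_
    obtain ⟨p, rfl⟩ := hasCentraliserChain_iff_exists_ltSeries.1 hn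
    exact le_iSup (fun p : LTSeries (Centralisers G) => (p.length : ℕ∞)) p
  · exact iSup_le fun p => le_iSup₂_of_le p.length
      (hasCentraliserChain_iff_exists_ltSeries.2 ⟨p, rfl⟩) le_rfl

theorem HasCentraliserChain.le_cdim {G : Type*} [Group G] {n : ℕ}
    (h : HasCentraliserChain G n) : (n : ℕ∞) ≤ cdim G :=
  le_iSup₂_of_le n h le_rfl

theorem cdim_le {G : Type*} [Group G] {d : ℕ∞}
    (h : ∀ n : ℕ, HasCentraliserChain G n → (n : ℕ∞) ≤ d) : cdim G ≤ d :=
  iSup₂_le h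

/-! ### Injective homomorphisms and subgroups. -/

/-- The centraliser in `G` of the image under `f` of the centraliser of `C`. -/
def pushCentraliser {H G : Type*} [Group H] [Group G] (f : H →* G) (C : Subgroup H) :
    Subgroup G :=
  Subgroup.centralizer (f '' (Subgroup.centralizer (C : Set H)))

theorem pushCentraliser_mono {H G : Type*} [Group H] [Group G] (f : H →* G) :
    Monotone (pushCentraliser f) := fun _ _ h =>
  Subgroup.centralizer_le (Set.image_mono (Subgroup.centralizer_le h))

/-- By injectivity, `f x` centralises `f(C_H(C))` exactly when `x` centralises `C_H(C)`, so the
pullback is the double centraliser of `C`. -/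
theorem comap_pushCentraliser {H G : Type*} [Group H] [Group G] {f : H →* G}
    (hf : Function.Injective f) {C : Subgroup H} (hC : IsCentraliser C) :
    (pushCentraliser f C).comap f = C := by
  conv_rhs => rw [← hC.centralizer_centralizer]
  ext x
  simp only [pushCentraliser, Subgroup.mem_comap, Subgroup.mem_centralizer_iff, Set.forall_mem_image,
    ← map_mul, hf.eq_iff]

/-- The map on centralisers that is induced by an injective homomorphism. -/
def Centralisers.push {H G : Type*} [Group H] [Group G] (f : H →* G) (C : Centralisers H) :
    Centralisers G :=
  ⟨pushCentraliser f C.1, isCentraliser_centralizer _⟩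

theorem Centralisers.push_strictMono {H G : Type*} [Group H] [Group G] {f : H →* G}
    (hf : Function.Injective f) : StrictMono (Centralisers.push f) := by
  refine Monotone.strictMono_of_injective (fun C D h => pushCentraliser_mono f h) ?_
  intro C D h
  refine Subtype.ext ?_
  rw [← comap_pushCentraliser hf C.2, ← comap_pushCentraliser hf D.2]
  exact congrArg (fun E : Centralisers G => E.1.comap f) h

theorem cdim_le_of_injective {H G : Type*} [Group H] [Group G] {f : H →* G}
    (hf : Function.Injective f) : cdim H ≤ cdim G := by
  rw [← WithBot.coe_le_coe, coe_cdim, coe_cdim]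
  exact Order.krullDim_le_of_strictMono _ (Centralisers.push_strictMono hf)

/-! ### Direct products. -/

/-- The Krull dimension of a product of nonempty finite-dimensional partial orders. -/
theorem krullDim_prod_eq {α β : Type*} [PartialOrder α] [PartialOrder β] {m n : ℕ}
    (hα : Order.krullDim α = m) (hβ : Order.krullDim β = n) :
    Order.krullDim (α × β) = (m + n : ℕ) := by
  apply le_antisymm
  · have hα' : ∀ a : α, Order.height a ≤ m := fun a => by
      rw [← WithBot.coe_le_coe]; exact (Order.height_le_krullDim a).trans hα.le
    have hβ' : ∀ b : β, Order.height b ≤ n := fun b => by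
      rw [← WithBot.coe_le_coe]; exact (Order.height_le_krullDim b).trans hβ.le
    have hα'' : ∀ a : α, Order.height a < ⊤ := fun a => (hα' a).trans_lt (ENat.natCast_lt_top m)
    have hβ'' : ∀ b : β, Order.height b < ⊤ := fun b => (hβ' b).trans_lt (ENat.natCast_lt_top n)
    have mα : StrictMono fun a : α => (Order.height a).toNat := fun a b hab => by
      rw [← ENat.natCast_lt_natCast, ENat.natCast_toNat (hα'' a).ne, ENat.natCast_toNat (hα'' b).ne]
      exact Order.height_strictMono hab (hα'' a)
    have mβ : StrictMono fun b : β => (Order.height b).toNat := fun a b hab => by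
      rw [← ENat.natCast_lt_natCast, ENat.natCast_toNat (hβ'' a).ne, ENat.natCast_toNat (hβ'' b).ne]
      exact Order.height_strictMono hab (hβ'' a)
    -- The sum of the heights is a rank function on the product with values in `ℕ`, bounded by `m +
    -- n`.
    have hf : StrictMono fun x : α × β =>
        (Order.height x.1).toNat + (Order.height x.2).toNat := by
      intro x y hxy
      rcases Prod.lt_iff.1 hxy with ⟨h1, h2⟩ | ⟨h1, h2⟩
      · exact add_lt_add_of_lt_of_le (mα h1) (mβ.monotone h2)
      · exact add_lt_add_of_le_of_lt (mα.monotone h1) (mβ h2)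
    refine iSup_le fun p => ?_
    have h1 := Order.length_le_height_last (p := p.map _ hf)
    rw [Order.height_nat] at h1
    have h2 : p.length ≤ (Order.height p.last.1).toNat + (Order.height p.last.2).toNat := by
      exact_mod_cast h1
    have h3 : (Order.height p.last.1).toNat ≤ m := ENat.toNat_le_of_le_natCast (hα' _)
    have h4 : (Order.height p.last.2).toNat ≤ n := ENat.toNat_le_of_le_natCast (hβ' _)
    exact_mod_cast h2.trans (add_le_add h3 h4)
  · obtain ⟨p, rfl⟩ := Order.le_krullDim_iff.1 hα.ge
    obtain ⟨q, rfl⟩ := Order.le_krullDim_iff.1 hβ.ge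
    -- A longest chain climbs along `p` at the bottom of `q`, then along `q` at the top of `p`.
    refine Order.le_krullDim_iff.2 ⟨RelSeries.smash
      (p.map (fun a => (a, q.head)) fun a b h => Prod.mk_lt_mk_iff_left.2 h)
      (q.map (fun b => (p.last, b)) fun a b h => Prod.mk_lt_mk_iff_right.2 h) rfl, rfl⟩

theorem centralizer_prod_eq {G H : Type*} [Group G] [Group H] (S : Set (G × H)) :
    Subgroup.centralizer S =
      (Subgroup.centralizer (Prod.fst '' S)).prod (Subgroup.centralizer (Prod.snd '' S)) := by
  ext x
  simp only [Subgroup.mem_prod, Subgroup.mem_centralizer_iff, Set.forall_mem_image, Prod.ext_iff,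
    Prod.fst_mul, Prod.snd_mul]
  grind

theorem IsCentraliser.prod {G H : Type*} [Group G] [Group H] {C : Subgroup G} {D : Subgroup H}
    (hC : IsCentraliser C) (hD : IsCentraliser D) : IsCentraliser (C.prod D) := by
  obtain ⟨S, rfl⟩ := hC
  obtain ⟨T, rfl⟩ := hD
  -- The entry `1` imposes no condition on the other coordinate. The set `S ×ˢ T` would fail when
  -- exactly one of the sets is empty.
  refine ⟨(fun s => (s, 1)) '' S ∪ (fun t => (1, t)) '' T, ?_⟩
  ext x
  simp only [Subgroup.mem_prod, Subgroup.mem_centralizer_iff, Set.mem_union, or_imp, forall_and,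
    Set.forall_mem_image, Prod.ext_iff, Prod.fst_mul, Prod.snd_mul, one_mul, mul_one,
    implies_true, and_true, true_and]

/-- The centralisers of a direct product are the products of centralisers of the factors. -/
noncomputable def Centralisers.prodEquiv (G H : Type*) [Group G] [Group H] :
    Centralisers G × Centralisers H ≃o Centralisers (G × H) :=
  RelIso.ofSurjective (OrderEmbedding.ofMapLEIff
    (fun C : Centralisers G × Centralisers H =>
      (⟨C.1.1.prod C.2.1, C.1.2.prod C.2.2⟩ : Centralisers (G × H)))
    (by
      rintro ⟨C, D⟩ ⟨C', D'⟩
      change C.1.prod D.1 ≤ C'.1.prod D'.1 ↔ C.1 ≤ C'.1 ∧ D.1 ≤ D'.1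
      refine ⟨fun h => ⟨fun x hx => ?_, fun x hx => ?_⟩, fun h => Subgroup.prod_mono h.1 h.2⟩
      · exact (h (show (x, 1) ∈ C.1.prod D.1 from ⟨hx, one_mem _⟩)).1
      · exact (h (show (1, x) ∈ C.1.prod D.1 from ⟨one_mem _, hx⟩)).2))
    (by
      rintro ⟨_, S, rfl⟩
      exact ⟨(⟨_, isCentraliser_centralizer (Prod.fst '' S)⟩,
        ⟨_, isCentraliser_centralizer (Prod.snd '' S)⟩), Subtype.ext (centralizer_prod_eq S).symm⟩)

theorem cdim_prod {G H : Type*} [Group G] [Group H] (hG : cdim G < ⊤) (hH : cdim H < ⊤) :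
    cdim (G × H) = cdim G + cdim H := by
  obtain ⟨m, hm⟩ := ENat.ne_top_iff_exists.1 hG.ne
  obtain ⟨n, hn⟩ := ENat.ne_top_iff_exists.1 hH.ne
  rw [← WithBot.coe_inj, coe_cdim, ← Order.krullDim_eq_of_orderIso (Centralisers.prodEquiv G H),
    krullDim_prod_eq (m := m) (n := n) (by rw [← coe_cdim, ← hm]; rfl)
      (by rw [← coe_cdim, ← hn]; rfl), ← hm, ← hn]
  rfl

/-! ### General bounds for the centraliser dimension. -/

/-- The chain is `G > C_G(x) > Z(G)`, with `y` witnessing the first strict inclusion and `x` the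
second. -/
theorem two_le_cdim {G : Type*} [Group G] {x y : G} (h : x * y ≠ y * x) : 2 ≤ cdim G := by
  have hx : x ∈ Subgroup.centralizer {x} := by simp [Subgroup.mem_centralizer_iff]
  have hy : y ∉ Subgroup.centralizer {x} := by simpa [Subgroup.mem_centralizer_iff] using h
  have hz : x ∉ Subgroup.center G := fun hx => h (Subgroup.mem_center_iff.1 hx y).symm
  refine (HasCentraliserChain.le_cdim (n := 2) (hasCentraliserChain_iff.2 ⟨fun i =>
    if i = 0 then ⊤ else if i = 1 then Subgroup.centralizer {x} else Subgroup.center G, ?_, ?_⟩))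
  · intro i hi
    interval_cases i
    · exact lt_top_iff_ne_top.2 fun h' => hy (by
        have : Subgroup.centralizer {x} = ⊤ := by simpa using h'
        rw [this]; trivial)
    · exact lt_of_le_of_ne (Subgroup.center_le_centralizer _) fun h' => hz (by
        have : Subgroup.center G = Subgroup.centralizer {x} := by simpa using h'
        rwa [this])
  · intro i hi
    dsimp only
    split_ifs
    · exact isCentraliser_top
    · exact isCentraliser_centralizer _
    · exact isCentraliser_center

theorem mem_center_iff_commute {G : Type*} [Group G] {x : G} :
    x ∈ Subgroup.center G ↔ ∀ y, Commute x y :=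
  Subgroup.mem_center_iff.trans (forall_congr' fun _ => eq_comm)

theorem mem_centralizer_iff_commute {G : Type*} [Group G] {S : Set G} {x : G} :
    x ∈ Subgroup.centralizer S ↔ ∀ s ∈ S, Commute x s :=
  Subgroup.mem_centralizer_iff.trans (forall₂_congr fun _ _ => eq_comm)

/-- A centraliser that lies in `K` together with its own centraliser is a centraliser of `K`. -/
theorem IsCentraliser.subgroupOf {G : Type*} [Group G] {C K : Subgroup G} (hC : IsCentraliser C)
    (h : Subgroup.centralizer (C : Set G) ≤ K) : IsCentraliser (C.subgroupOf K) := by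
  refine ⟨{s : K | (s : G) ∈ Subgroup.centralizer (C : Set G)}, ?_⟩
  ext x
  rw [Subgroup.mem_subgroupOf, mem_centralizer_iff_commute]
  constructor
  · intro hx s hs
    exact Subtype.ext (mem_centralizer_iff_commute.1 hs _ hx).symm
  · intro hx
    rw [← hC.centralizer_centralizer, mem_centralizer_iff_commute]
    intro s hs
    exact congrArg Subtype.val (hx ⟨s, h hs⟩ hs)

theorem subgroupOf_lt_subgroupOf {G : Type*} [Group G] {C D K : Subgroup G} (h : C < D)
    (hD : D ≤ K) : C.subgroupOf K < D.subgroupOf K := by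
  obtain ⟨x, hxD, hxC⟩ := SetLike.exists_of_lt h
  refine lt_of_le_of_ne (Subgroup.comap_mono h.le) fun he => hxC ?_
  have : (⟨x, hD hxD⟩ : K) ∈ D.subgroupOf K := hxD
  rw [← he] at this
  exact this

/-- An upper bound for the centraliser dimension of a group in which every noncentral element
either has an abelian centraliser that is determined by any of its noncentral elements, or lies in
a subgroup of small centraliser dimension that contains the centralisers of its noncentral
elements. -/
theorem cdim_le_of_forall_noncentral {G : Type*} [Group G] {d : ℕ∞} (hd : 2 ≤ d)
    (h : ∀ g ∉ Subgroup.center G,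
      (∀ t ∉ Subgroup.center G, Commute t g → ∀ u v, Commute u t → Commute v g → Commute v u) ∨
      ∃ K : Subgroup G, g ∈ K ∧
        (∀ t ∈ K, t ∉ Subgroup.center G → ∀ u, Commute u t → u ∈ K) ∧
        (cdim K + 2 ≤ d ∨
          cdim K ≤ d ∧ ∀ x ∈ K, (∀ y ∈ K, Commute x y) → x ∈ Subgroup.center G)) :
    cdim G ≤ d := by
  refine cdim_le fun n hn => ?_
  -- For `n > 2` the term `C 2` still lies at or above `C (n - 1)`, hence contains the element `t`
  -- chosen below.
  rcases le_or_gt n 2 with hn2 | hn2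
  · exact le_trans (by exact_mod_cast hn2) hd
  obtain ⟨C, hlt, hC⟩ := hasCentraliserChain_iff.1 hn
  have anti : ∀ i j, i ≤ j → j ≤ n → C j ≤ C i := by
    intro i j hij
    induction j, hij using Nat.le_induction with
    | base => exact fun _ => le_rfl
    | succ j _ ih => exact fun hj => (hlt j hj).le.trans (ih (by omega))
  -- If the centraliser of `C 1` were central, `C 1` would be its own double centraliser, all of
  -- `G`, against `C 1 < C 0`.
  obtain ⟨g, hgC, hg⟩ : ∃ g ∈ Subgroup.centralizer (C 1 : Set G), g ∉ Subgroup.center G := by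
    by_contra! hall
    refine (hlt 0 (by omega)).not_ge ?_
    rw [zero_add, ← (hC 1 (by omega)).centralizer_centralizer]
    refine fun x _ => mem_centralizer_iff_commute.2 fun s hs => ?_
    exact (mem_center_iff_commute.1 (hall s hs) x).symm
  obtain ⟨t, htC, ht⟩ : ∃ t ∈ C (n - 1), t ∉ Subgroup.center G := by
    have h1 : C n < C (n - 1) := by
      have := hlt (n - 1) (by omega)
      rwa [Nat.sub_add_cancel (by omega)] at this
    obtain ⟨t, h2, h3⟩ := SetLike.exists_of_lt h1
    exact ⟨t, h2, fun h4 => h3 ((hC n le_rfl).center_le h4)⟩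
  have htj : ∀ j ≤ n - 1, t ∈ C j := fun j hj => anti j (n - 1) hj (by omega) htC
  have hcg : ∀ x ∈ C 1, Commute x g := fun x hx =>
    (mem_centralizer_iff_commute.1 hgC x hx).symm
  -- In the first case `C 1` centralises `C_G(C 2)`, hence `C 1 ≤ C 2`.
  rcases h g hg with habel | ⟨K, hgK, hK, hdim⟩
  · exfalso
    refine (hlt 1 (by omega)).not_ge fun v hv => ?_
    rw [one_add_one_eq_two, ← (hC 2 (by omega)).centralizer_centralizer]
    refine mem_centralizer_iff_commute.2 fun u hu => ?_
    exact habel t ht (hcg t (htj 1 (by omega))) u v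
      (mem_centralizer_iff_commute.1 hu t (htj 2 (by omega))) (hcg v hv)
  have hCK : ∀ j, 1 ≤ j → j ≤ n → C j ≤ K := fun j hj hjn x hx =>
    hK g hgK hg x (hcg x (anti 1 j hj hjn hx))
  have htK : t ∈ K := hCK (n - 1) (by omega) (by omega) htC
  have hcent : ∀ j, j ≤ n - 1 → IsCentraliser ((C j).subgroupOf K) := fun j hj =>
    (hC j (by omega)).subgroupOf fun u hu =>
      hK t htK ht u (mem_centralizer_iff_commute.1 hu t (htj j hj))
  rcases hdim with hdim | ⟨hdim, hZ⟩
  · refine le_trans ?_ hdim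
    have : HasCentraliserChain K (n - 2) := hasCentraliserChain_iff.2
      ⟨fun i => (C (i + 1)).subgroupOf K,
        fun i hi => subgroupOf_lt_subgroupOf (hlt _ (by omega)) (hCK _ (by omega) (by omega)),
        fun i hi => hcent _ (by omega)⟩
    calc (n : ℕ∞) = ((n - 2 : ℕ) : ℕ∞) + 2 := by
          exact_mod_cast (Nat.sub_add_cancel (show 2 ≤ n by omega)).symm
      _ ≤ cdim K + 2 := by gcongr; exact this.le_cdim
  · refine le_trans (HasCentraliserChain.le_cdim ?_) hdim
    -- The two end terms are replaced by `K` and `Z(K)`. Strictness holds because neither `g` nor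
    -- `t` is central in `K`, as `Z(K) ≤ Z(G)`.
    refine hasCentraliserChain_iff.2 ⟨fun i => if i = 0 then ⊤ else if i = n then
      Subgroup.center K else (C i).subgroupOf K, fun i hi => ?_, fun i hi => ?_⟩
    · simp only [Nat.add_eq_zero_iff, one_ne_zero, and_false, if_false, hi.ne]
      by_cases hi0 : i = 0
      · subst hi0
        rw [if_neg (by omega), if_pos rfl, lt_top_iff_ne_top]
        intro he
        refine hg (hZ g hgK fun y hy => (hcg y ?_).symm)
        have : (⟨y, hy⟩ : K) ∈ (C (0 + 1)).subgroupOf K := by rw [he]; trivial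
        exact this
      rw [if_neg hi0]
      by_cases hin : i + 1 = n
      · rw [if_pos hin]
        refine lt_of_le_of_ne (hcent i (by omega)).center_le fun he => ht (hZ t htK ?_)
        have : (⟨t, htK⟩ : K) ∈ Subgroup.center K := by
          rw [he]
          exact htj i (by omega)
        exact fun y hy => congrArg Subtype.val (mem_center_iff_commute.1 this ⟨y, hy⟩)
      · rw [if_neg hin]
        exact subgroupOf_lt_subgroupOf (hlt i hi) (hCK i (by omega) hi.le)
    · dsimp only
      split_ifs with h0 h1
      · exact isCentraliser_top
      · exact isCentraliser_center
      · exact hcent i (by omega)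

open Monoid in
/-- An upper bound for the centraliser dimension of a central extension of a free product. -/
theorem cdim_le_of_hom_coprodI {G : Type*} [Group G] {ι : Type*} {M L : ι → Type*}
    [∀ i, Group (M i)] [∀ i, Group (L i)] {π : G →* CoprodI M} (hπ : Function.Surjective π)
    (hker : ∀ x, π x = 1 ↔ x ∈ Subgroup.center G)
    {f : ∀ i, L i →* G} (hf : ∀ i, Function.Injective (f i))
    (hfM : ∀ i a, ∃ m : M i, π (f i a) = CoprodI.of m)
    (hrange : ∀ (i : ι) (m : M i) (x : G), π x = CoprodI.of m → ∃ a, f i a = x)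
    {d : ℕ∞} (hd : 2 ≤ d)
    (hL : ∀ i, cdim (L i) + 2 ≤ d ∨
      cdim (L i) ≤ d ∧ ∀ a ∈ Subgroup.center (L i), f i a ∈ Subgroup.center G) :
    cdim G ≤ d := by
  refine cdim_le_of_forall_noncentral hd fun g hg => ?_
  rcases CoprodI.conj_of_or_cyclic_centralizer (π g) (fun h => hg ((hker g).1 h)) with
    ⟨y, i, m, hy⟩ | ⟨c, hc⟩
  · obtain ⟨z, rfl⟩ := hπ y
    -- `K` is the conjugate of the image of `L i` that contains `g`.
    set k : L i →* G := (MulAut.conj z⁻¹).toMonoidHom.comp (f i) with hk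
    have hkapp : ∀ a, k a = z⁻¹ * f i a * z := fun a => by simp [hk]
    have hkinj : Function.Injective k := (MulAut.conj z⁻¹).injective.comp (hf i)
    have hmem : ∀ (n : M i) (x : G), π (z * x * z⁻¹) = CoprodI.of n → x ∈ k.range := by
      intro n x hx
      obtain ⟨a, ha⟩ := hrange i n _ hx
      exact ⟨a, by rw [hkapp, ha]; group⟩
    have hdim : cdim k.range ≤ cdim (L i) :=
      cdim_le_of_injective (f := (MonoidHom.ofInjective hkinj).symm.toMonoidHom)
        (MonoidHom.ofInjective hkinj).symm.injective
    refine Or.inr ⟨k.range, hmem m g (by simpa using hy), ?_, ?_⟩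
    · rintro _ ⟨a, rfl⟩ ha u hu
      obtain ⟨n, hn⟩ := hfM i a
      have hn1 : n ≠ 1 := by
        rintro rfl
        apply ha
        rw [← hker, hkapp, map_mul, map_mul, hn]
        simp
      have hcomm : Commute (π (z * u * z⁻¹)) (CoprodI.of n) := by
        rw [← hn]
        refine Commute.map ?_ π
        have h1 := hu.map (MulAut.conj z).toMonoidHom
        have h2 : (MulAut.conj z).toMonoidHom (k a) = f i a := by simp [hkapp, mul_assoc]
        rw [h2] at h1
        simpa using h1
      obtain ⟨n', hn'⟩ := CoprodI.mem_range_of_commute hn1 hcomm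
      exact hmem n' u hn'
    · refine (hL i).imp (fun h => le_trans (by gcongr) h) fun h => ⟨hdim.trans h.1, ?_⟩
      rintro _ ⟨a, rfl⟩ ha
      have hac : f i a ∈ Subgroup.center G := h.2 a (mem_center_iff_commute.2 fun b =>
        hkinj (by simpa only [map_mul] using (ha (k b) ⟨b, rfl⟩).eq))
      rw [hkapp, mul_assoc, ← Subgroup.mem_center_iff.1 hac z, inv_mul_cancel_left]
      exact hac
  · obtain ⟨c, rfl⟩ := hπ c
    refine Or.inl fun t ht htg u v hu hv => ?_
    -- The preimage of a cyclic group under a map with central kernel consists of the products `c ^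
    -- n * w` with `w` central, so it is abelian.
    have hpow : ∀ x, π x ∈ Subgroup.zpowers (π c) →
        ∃ (n : ℤ) (w : G), w ∈ Subgroup.center G ∧ x = c ^ n * w := by
      intro x hx
      obtain ⟨n, hn⟩ := Subgroup.mem_zpowers_iff.1 hx
      refine ⟨n, (c ^ n)⁻¹ * x, (hker _).1 ?_, by group⟩
      rw [map_mul, map_inv, map_zpow, hn, inv_mul_cancel]
    obtain ⟨a, w, hw, rfl⟩ := hpow u
      (hc _ (fun h => ht ((hker t).1 h)) (htg.map π) _ (hu.map π))
    obtain ⟨b, w', hw', rfl⟩ := hpow v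
      (hc _ (fun h => hg ((hker g).1 h)) (Commute.refl _) _ (hv.map π))
    have h1 := mem_center_iff_commute.1 hw
    have h2 := mem_center_iff_commute.1 hw'
    exact Commute.mul_left (((Commute.refl c).zpow_zpow b a).mul_right (h1 _).symm) (h2 _)

/-- If `f` maps a central element to a noncentral one, then chains of centralisers can be extended
at both ends. -/
theorem cdim_add_two_le {H G : Type*} [Group H] [Group G] {f : H →* G}
    (hf : Function.Injective f) {z : H} (hz : z ∈ Subgroup.center H)
    (hfz : f z ∉ Subgroup.center G) : cdim H + 2 ≤ cdim G := by
  let F : WithTop (WithBot (Centralisers H)) → Centralisers G := fun C =>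
    WithTop.recTopCoe ⟨⊤, isCentraliser_top⟩ (fun C => WithBot.recBotCoe
      ⟨Subgroup.center G, isCentraliser_center⟩ (fun C => Centralisers.push f C) C) C
  -- Since `z` is central in `H`, the element `f z` is among those that a pushed centraliser must
  -- centralise; it also lies in every pushed centraliser. As it is not central in `G`, all of these
  -- lie strictly between `Z(G)` and `G`.
  have htop : ∀ C : Centralisers H, (Centralisers.push f C).1 < ⊤ := by
    intro C
    refine lt_top_iff_ne_top.2 fun h => hfz (mem_center_iff_commute.2 fun y => ?_)
    have hy : y ∈ (Centralisers.push f C).1 := by rw [h]; trivial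
    exact (mem_centralizer_iff_commute.1 hy (f z)
      ⟨z, Subgroup.center_le_centralizer _ hz, rfl⟩).symm
  have hbot : ∀ C : Centralisers H, Subgroup.center G < (Centralisers.push f C).1 := by
    intro C
    refine lt_of_le_of_ne (Centralisers.push f C).2.center_le fun h => hfz ?_
    rw [h]
    refine mem_centralizer_iff_commute.2 ?_
    rintro _ ⟨s, -, rfl⟩
    exact (mem_center_iff_commute.1 hz s).map f
  have hF : StrictMono F := by
    refine WithTop.strictMono_iff.2 ⟨WithBot.strictMono_iff.2
      ⟨Centralisers.push_strictMono hf, hbot⟩, fun C => ?_⟩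
    induction C using WithBot.recBotCoe with
    | bot => exact (hbot ⟨⊤, isCentraliser_top⟩).trans (htop _)
    | coe C => exact htop C
  have h := Order.krullDim_le_of_strictMono F hF
  rw [Order.krullDim_WithTop, Order.krullDim_withBot, ← coe_cdim, ← coe_cdim, add_assoc,
    one_add_one_eq_two] at h
  exact WithBot.coe_le_coe.1 h

-- Pairs of groups as families, and free products.

universe u v w

/-- A pair of groups as a family indexed by `Bool`, in a common universe. -/
def PairFamily (A : Type u) (B : Type v) : Bool → Type (max u v)
  | true => ULift.{v} A
  | false => ULift.{u} B

namespace PairFamily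

variable {A : Type u} {B : Type v} [Group A] [Group B]

instance group : ∀ b, Group (PairFamily A B b)
  | true => inferInstanceAs (Group (ULift.{v} A))
  | false => inferInstanceAs (Group (ULift.{u} B))

variable (A B) in
/-- The first group of a pair is isomorphic to the first member of the family. -/
def fst : A ≃* PairFamily A B true := MulEquiv.ulift.symm

variable (A B) in
/-- The second group of a pair is isomorphic to the second member of the family. -/
def snd : B ≃* PairFamily A B false := MulEquiv.ulift.symm

/-- A pair of homomorphisms as a family of homomorphisms. -/
def lift {G : Type w} [Group G] (f : A →* G) (g : B →* G) : ∀ b, PairFamily A B b →* G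
  | true => f.comp (fst A B).symm.toMonoidHom
  | false => g.comp (snd A B).symm.toMonoidHom

@[simp]
theorem lift_fst {G : Type w} [Group G] (f : A →* G) (g : B →* G) (a : A) :
    lift f g true (fst A B a) = f a := rfl

@[simp]
theorem lift_snd {G : Type w} [Group G] (f : A →* G) (g : B →* G) (b : B) :
    lift f g false (snd A B b) = g b := rfl

variable (A B) in
theorem cdim_true : cdim (PairFamily A B true) = cdim A :=
  le_antisymm (cdim_le_of_injective (f := (fst A B).symm.toMonoidHom) (fst A B).symm.injective)
    (cdim_le_of_injective (f := (fst A B).toMonoidHom) (fst A B).injective)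

variable (A B) in
theorem cdim_false : cdim (PairFamily A B false) = cdim B :=
  le_antisymm (cdim_le_of_injective (f := (snd A B).symm.toMonoidHom) (snd A B).symm.injective)
    (cdim_le_of_injective (f := (snd A B).toMonoidHom) (snd A B).injective)

end PairFamily

open Monoid

theorem cdim_le_cdim_add_zOf {A : Type*} [Group A] : cdim A ≤ cdim A + zOf A := le_self_add

/-- A nontrivial group with trivial centre is nonabelian; otherwise `z` contributes the 2. -/
theorem two_le_cdim_add_zOf (A : Type*) [Group A] [Nontrivial A] : 2 ≤ cdim A + zOf A := by
  by_cases h : Subgroup.center A = ⊥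
  · obtain ⟨x, hx⟩ := exists_ne (1 : A)
    have hxc : x ∉ Subgroup.center A := by rwa [h, Subgroup.mem_bot]
    rw [Subgroup.mem_center_iff] at hxc
    push Not at hxc
    obtain ⟨y, hy⟩ := hxc
    exact (two_le_cdim hy).trans cdim_le_cdim_add_zOf
  · rw [zOf, if_neg h]
    exact le_add_self

theorem cdim_add_zOf_le {A G : Type*} [Group A] [Group G] {f : A →* G}
    (hf : Function.Injective f) (hG : Subgroup.center G = ⊥) : cdim A + zOf A ≤ cdim G := by
  by_cases h : Subgroup.center A = ⊥
  · rw [zOf, if_pos h, add_zero]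
    exact cdim_le_of_injective hf
  · rw [zOf, if_neg h]
    obtain ⟨z, hz, hz1⟩ := (Subgroup.bot_or_exists_ne_one _).resolve_left h
    refine cdim_add_two_le hf hz ?_
    rw [hG, Subgroup.mem_bot, map_eq_one_iff f hf]
    exact hz1

/-- Supplies the last hypothesis of `cdim_le_of_hom_coprodI` for a factor: a trivial centre maps to
`1`, and a nontrivial one provides the slack of 2. -/
theorem cdim_add_two_le_or_of_cdim_add_zOf_le {A L G : Type*} [Group A] [Group L] [Group G]
    (e : A ≃* L) (f : L →* G) {d : ℕ∞} (h : cdim L = cdim A) (hd : cdim A + zOf A ≤ d) :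
    cdim L + 2 ≤ d ∨
      cdim L ≤ d ∧ ∀ a ∈ Subgroup.center L, f a ∈ Subgroup.center G := by
  rw [h]
  by_cases hz : Subgroup.center A = ⊥
  · refine Or.inr ⟨cdim_le_cdim_add_zOf.trans hd, fun a ha => ?_⟩
    have : e.symm a ∈ Subgroup.center A := mem_center_iff_commute.2 fun y => by
      simpa using (mem_center_iff_commute.1 ha (e y)).map e.symm
    rw [hz, Subgroup.mem_bot, MulEquiv.map_eq_one_iff] at this
    rw [this, map_one]
    exact one_mem _
  · rw [zOf, if_neg hz] at hd
    exact Or.inl hd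

section FreeProduct

variable (G₁ : Type u) (G₂ : Type v) [Group G₁] [Group G₂]

/-- The binary free product as a free product of a family. -/
def coprodEquivCoprodI : Coprod G₁ G₂ ≃* CoprodI (PairFamily G₁ G₂) :=
  MonoidHom.toMulEquiv
    (Coprod.lift (CoprodI.of.comp (PairFamily.fst G₁ G₂).toMonoidHom)
      (CoprodI.of.comp (PairFamily.snd G₁ G₂).toMonoidHom))
    (CoprodI.lift (PairFamily.lift Coprod.inl Coprod.inr))
    (by ext x <;> simp)
    (by ext b x; cases b <;> rfl)

variable {G₁ G₂}

theorem center_coprod [Nontrivial G₁] [Nontrivial G₂] :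
    Subgroup.center (Coprod G₁ G₂) = ⊥ := by
  rw [eq_bot_iff]
  intro x hx
  have : Nontrivial (PairFamily G₁ G₂ true) := (PairFamily.fst G₁ G₂).symm.toEquiv.nontrivial
  have : Nontrivial (PairFamily G₁ G₂ false) := (PairFamily.snd G₁ G₂).symm.toEquiv.nontrivial
  have h : coprodEquivCoprodI G₁ G₂ x = 1 := by
    refine CoprodI.eq_one_of_forall_commute (i := true) (j := false) (by simp) fun y => ?_
    obtain ⟨y, rfl⟩ := (coprodEquivCoprodI G₁ G₂).surjective y
    exact (mem_center_iff_commute.1 hx y).map _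
  simpa using h

theorem cdim_coprod [Nontrivial G₁] [Nontrivial G₂] :
    cdim (Coprod G₁ G₂) = max (cdim G₁ + zOf G₁) (cdim G₂ + zOf G₂) := by
  apply le_antisymm
  swap
  · exact max_le (cdim_add_zOf_le Coprod.inl_injective center_coprod)
      (cdim_add_zOf_le Coprod.inr_injective center_coprod)
  refine cdim_le_of_hom_coprodI (π := (coprodEquivCoprodI G₁ G₂).toMonoidHom)
    (L := PairFamily G₁ G₂) (f := PairFamily.lift Coprod.inl Coprod.inr)
    (coprodEquivCoprodI G₁ G₂).surjective ?_ ?_ ?_ ?_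
    ((two_le_cdim_add_zOf G₁).trans (le_max_left _ _)) ?_
  · intro x
    rw [center_coprod, Subgroup.mem_bot]
    exact (coprodEquivCoprodI G₁ G₂).map_eq_one_iff
  · rintro (_ | _)
    · exact Coprod.inr_injective.comp (PairFamily.snd G₁ G₂).symm.injective
    · exact Coprod.inl_injective.comp (PairFamily.fst G₁ G₂).symm.injective
  · rintro (_ | _) a <;> exact ⟨a, rfl⟩
  · rintro (_ | _) m x hx
    · exact ⟨m, (coprodEquivCoprodI G₁ G₂).injective hx.symm⟩
    · exact ⟨m, (coprodEquivCoprodI G₁ G₂).injective hx.symm⟩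
  · rintro (_ | _)
    · exact cdim_add_two_le_or_of_cdim_add_zOf_le (PairFamily.snd G₁ G₂) _
        (PairFamily.cdim_false G₁ G₂) (le_max_right _ _)
    · exact cdim_add_two_le_or_of_cdim_add_zOf_le (PairFamily.fst G₁ G₂) _
        (PairFamily.cdim_true G₁ G₂) (le_max_left _ _)

end FreeProduct

/-! ### Amalgamated products along the centres. -/

namespace AmalgamatedProduct

variable {G₁ : Type u} {G₂ : Type v} [Group G₁] [Group G₂]

section Embedding

variable {A : Subgroup G₁} {B : Subgroup G₂} (φ : A ≃* B)

/-- The inclusion of the first factor. -/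
def inl : G₁ →* AmalgamatedProduct φ := (QuotientGroup.mk' _).comp Coprod.inl

/-- The inclusion of the second factor. -/
def inr : G₂ →* AmalgamatedProduct φ := (QuotientGroup.mk' _).comp Coprod.inr

theorem inl_eq_inr (a : A) : inl φ a = inr φ (φ a) := by
  rw [← mul_inv_eq_one, inl, inr]
  simp only [MonoidHom.comp_apply, ← map_inv, ← map_mul]
  exact (QuotientGroup.eq_one_iff _).2 (Subgroup.subset_normalClosure ⟨a, by simp⟩)

variable {φ}

/-- The homomorphism given by compatible homomorphisms on the factors. -/
def lift {H : Type*} [Group H] (f : G₁ →* H) (g : G₂ →* H) (h : ∀ a : A, f a = g (φ a)) :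
    AmalgamatedProduct φ →* H :=
  QuotientGroup.lift (amalgamRelations φ) (Coprod.lift f g) (by
    refine Subgroup.normalClosure_le_normal (N := (Coprod.lift f g).ker) ?_
    rintro _ ⟨a, rfl⟩
    simp [MonoidHom.mem_ker, h])

theorem induction {p : AmalgamatedProduct φ → Prop} (hl : ∀ x, p (inl φ x))
    (hr : ∀ x, p (inr φ x)) (hm : ∀ x y, p x → p y → p (x * y)) (x : AmalgamatedProduct φ) :
    p x := by
  obtain ⟨x, rfl⟩ := QuotientGroup.mk_surjective x
  induction x using Coprod.induction_on with
  | inl x => exact hl x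
  | inr x => exact hr x
  | mul x y hx hy => exact hm _ _ hx hy

variable (φ) in
/-- The inclusions of the amalgamated subgroup into the factors. -/
def baseHom : ∀ b, A →* PairFamily G₁ G₂ b
  | true => (PairFamily.fst G₁ G₂).toMonoidHom.comp A.subtype
  | false => (PairFamily.snd G₁ G₂).toMonoidHom.comp (B.subtype.comp φ.toMonoidHom)

theorem baseHom_injective : ∀ b, Function.Injective (baseHom φ b)
  | true => (PairFamily.fst G₁ G₂).injective.comp A.subtype_injective
  | false => (PairFamily.snd G₁ G₂).injective.comp (B.subtype_injective.comp φ.injective)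

variable (φ) in
/-- The map to the pushout of the family. -/
def toPushoutI : AmalgamatedProduct φ →* PushoutI (baseHom φ) :=
  lift ((PushoutI.of true).comp (PairFamily.fst G₁ G₂).toMonoidHom)
    ((PushoutI.of false).comp (PairFamily.snd G₁ G₂).toMonoidHom) (fun a =>
      (PushoutI.of_apply_eq_base (baseHom φ) true a).trans
        (PushoutI.of_apply_eq_base (baseHom φ) false a).symm)

/-- Injectivity comes from the normal form theorem for pushouts: the composite with `toPushoutI` is
the inclusion of a factor. -/
theorem inl_injective : Function.Injective (inl φ) :=
  Function.Injective.of_comp (f := toPushoutI φ)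
    ((PushoutI.of_injective baseHom_injective true).comp (PairFamily.fst G₁ G₂).injective)

theorem inr_injective : Function.Injective (inr φ) :=
  Function.Injective.of_comp (f := toPushoutI φ)
    ((PushoutI.of_injective baseHom_injective false).comp (PairFamily.snd G₁ G₂).injective)

end Embedding

section Center

variable (φ : Subgroup.center G₁ ≃* Subgroup.center G₂)

theorem inl_mem_center (a : Subgroup.center G₁) :
    inl φ a ∈ Subgroup.center (AmalgamatedProduct φ) := by
  refine mem_center_iff_commute.2 fun y => ?_
  induction y using induction with
  | hl x => exact (mem_center_iff_commute.1 a.2 x).map (inl φ)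
  | hr x =>
    rw [inl_eq_inr]
    exact (mem_center_iff_commute.1 (φ a).2 x).map (inr φ)
  | hm x y hx hy => exact hx.mul_right hy

theorem inr_mem_center (b : Subgroup.center G₂) :
    inr φ b ∈ Subgroup.center (AmalgamatedProduct φ) := by
  have h := inl_eq_inr φ (φ.symm b)
  rw [φ.apply_symm_apply] at h
  rw [← h]
  exact inl_mem_center φ _

/-- The image of the amalgamated centre. -/
def base : Subgroup (AmalgamatedProduct φ) := (Subgroup.center G₁).map (inl φ)

theorem base_le_center : base φ ≤ Subgroup.center (AmalgamatedProduct φ) := by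
  rintro _ ⟨a, ha, rfl⟩
  exact inl_mem_center φ ⟨a, ha⟩

theorem inr_mem_base (b : Subgroup.center G₂) : inr φ b ∈ base φ := by
  refine ⟨φ.symm b, (φ.symm b).2, ?_⟩
  rw [inl_eq_inr, φ.apply_symm_apply]

instance base_normal : (base φ).Normal :=
  ⟨fun n hn g => by
    rwa [Subgroup.mem_center_iff.1 (base_le_center φ hn) g, mul_inv_cancel_right]⟩

/-- The map to the free product of the central quotients of the factors. -/
def toCoprodI : AmalgamatedProduct φ →*
    CoprodI (PairFamily (G₁ ⧸ Subgroup.center G₁) (G₂ ⧸ Subgroup.center G₂)) :=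
  lift (CoprodI.of.comp ((PairFamily.fst _ _).toMonoidHom.comp (QuotientGroup.mk' _)))
    (CoprodI.of.comp ((PairFamily.snd _ _).toMonoidHom.comp (QuotientGroup.mk' _)))
    (fun a => by
      have h1 : (QuotientGroup.mk' (Subgroup.center G₁)) (a : G₁) = 1 :=
        (QuotientGroup.eq_one_iff _).2 a.2
      have h2 : (QuotientGroup.mk' (Subgroup.center G₂)) (φ a : G₂) = 1 :=
        (QuotientGroup.eq_one_iff _).2 (φ a).2
      simp only [MonoidHom.comp_apply, h1, h2, map_one])

theorem toCoprodI_inl (x : G₁) :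
    toCoprodI φ (inl φ x) = CoprodI.of (PairFamily.fst _ (G₂ ⧸ Subgroup.center G₂)
      (x : G₁ ⧸ Subgroup.center G₁)) := rfl

theorem toCoprodI_inr (x : G₂) :
    toCoprodI φ (inr φ x) = CoprodI.of (PairFamily.snd (G₁ ⧸ Subgroup.center G₁) _
      (x : G₂ ⧸ Subgroup.center G₂)) := rfl

theorem exists_inl_of_toCoprodI (m : PairFamily (G₁ ⧸ Subgroup.center G₁)
    (G₂ ⧸ Subgroup.center G₂) true) : ∃ x, toCoprodI φ (inl φ x) = CoprodI.of m := by
  obtain ⟨m, rfl⟩ := (PairFamily.fst _ _).surjective m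
  obtain ⟨x, rfl⟩ := QuotientGroup.mk_surjective m
  exact ⟨x, toCoprodI_inl φ x⟩

theorem exists_inr_of_toCoprodI (m : PairFamily (G₁ ⧸ Subgroup.center G₁)
    (G₂ ⧸ Subgroup.center G₂) false) : ∃ x, toCoprodI φ (inr φ x) = CoprodI.of m := by
  obtain ⟨m, rfl⟩ := (PairFamily.snd _ _).surjective m
  obtain ⟨x, rfl⟩ := QuotientGroup.mk_surjective m
  exact ⟨x, toCoprodI_inr φ x⟩

theorem toCoprodI_surjective : Function.Surjective (toCoprodI φ) := by
  intro y
  induction y using CoprodI.induction_on with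
  | one => exact ⟨1, map_one _⟩
  | of i m =>
    cases i
    · exact (exists_inr_of_toCoprodI φ m).imp' (inr φ) fun _ h => h
    · exact (exists_inl_of_toCoprodI φ m).imp' (inl φ) fun _ h => h
  | mul x y hx hy =>
    obtain ⟨x, rfl⟩ := hx
    obtain ⟨y, rfl⟩ := hy
    exact ⟨x * y, map_mul _ _ _⟩

/-- The map from the free product of the central quotients back to the quotient by the amalgamated
centre. -/
def ofCoprodI : CoprodI (PairFamily (G₁ ⧸ Subgroup.center G₁) (G₂ ⧸ Subgroup.center G₂)) →*
    AmalgamatedProduct φ ⧸ base φ :=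
  CoprodI.lift (PairFamily.lift
    (QuotientGroup.map _ _ (inl φ) fun _ ha => Subgroup.mem_map_of_mem (inl φ) ha)
    (QuotientGroup.map _ _ (inr φ) fun b hb => inr_mem_base φ ⟨b, hb⟩))

theorem ofCoprodI_toCoprodI (x : AmalgamatedProduct φ) :
    ofCoprodI φ (toCoprodI φ x) = (x : AmalgamatedProduct φ ⧸ base φ) := by
  induction x using induction with
  | hl x => rw [toCoprodI_inl, ofCoprodI, CoprodI.lift_of]; rfl
  | hr x => rw [toCoprodI_inr, ofCoprodI, CoprodI.lift_of]; rfl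
  | hm x y hx hy => rw [map_mul, map_mul, hx, hy]; rfl

/-- `ofCoprodI` recovers an element modulo the amalgamated centre, so nothing else can be in the
kernel. -/
theorem mem_base_of_toCoprodI_eq_one {x : AmalgamatedProduct φ} (h : toCoprodI φ x = 1) :
    x ∈ base φ := by
  rw [← QuotientGroup.eq_one_iff, ← ofCoprodI_toCoprodI, h, map_one]

end Center

theorem nontrivial_quotient_center {G : Type*} [Group G] (h : ∃ x y : G, x * y ≠ y * x) :
    Nontrivial (G ⧸ Subgroup.center G) := by
  obtain ⟨x, y, hxy⟩ := h
  refine ⟨(x : G ⧸ Subgroup.center G), 1, fun hx => hxy ?_⟩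
  exact (Subgroup.mem_center_iff.1 ((QuotientGroup.eq_one_iff x).1 hx) y).symm

/-- The centraliser dimension of an amalgamated product of non-abelian groups along their
centres. -/
theorem cdim_eq_max (φ : Subgroup.center G₁ ≃* Subgroup.center G₂)
    (h₁ : ∃ x y : G₁, x * y ≠ y * x) (h₂ : ∃ x y : G₂, x * y ≠ y * x) :
    cdim (AmalgamatedProduct φ) = max (cdim G₁) (cdim G₂) := by
  apply le_antisymm
  swap
  · exact max_le (cdim_le_of_injective inl_injective) (cdim_le_of_injective inr_injective)
  have hd : 2 ≤ max (cdim G₁) (cdim G₂) := by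
    obtain ⟨x, y, hxy⟩ := h₁
    exact (two_le_cdim hxy).trans (le_max_left _ _)
  refine cdim_le_of_hom_coprodI (L := PairFamily G₁ G₂) (f := PairFamily.lift (inl φ) (inr φ))
    (toCoprodI_surjective φ) ?_ ?_ ?_ ?_ hd ?_
  -- The kernel is all of the centre: both central quotients are nontrivial because the factors are
  -- nonabelian, so their free product has trivial centre, and surjectivity sends central elements
  -- there.
  · refine fun x => ⟨fun h => base_le_center φ (mem_base_of_toCoprodI_eq_one φ h), fun hx => ?_⟩
    have := nontrivial_quotient_center h₁
    have := nontrivial_quotient_center h₂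
    have : Nontrivial (PairFamily (G₁ ⧸ Subgroup.center G₁) (G₂ ⧸ Subgroup.center G₂) true) :=
      (PairFamily.fst _ _).symm.toEquiv.nontrivial
    have : Nontrivial (PairFamily (G₁ ⧸ Subgroup.center G₁) (G₂ ⧸ Subgroup.center G₂) false) :=
      (PairFamily.snd _ _).symm.toEquiv.nontrivial
    refine CoprodI.eq_one_of_forall_commute (i := true) (j := false) (by simp) fun y => ?_
    obtain ⟨y, rfl⟩ := toCoprodI_surjective φ y
    exact (mem_center_iff_commute.1 hx y).map _
  · rintro (_ | _)
    · exact inr_injective.comp (PairFamily.snd G₁ G₂).symm.injective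
    · exact inl_injective.comp (PairFamily.fst G₁ G₂).symm.injective
  · rintro (_ | _) a
    · exact ⟨_, toCoprodI_inr φ _⟩
    · exact ⟨_, toCoprodI_inl φ _⟩
  · rintro (_ | _) m x hx
    · obtain ⟨y, hy⟩ := exists_inr_of_toCoprodI φ m
      -- `x` differs from `inr φ y` by an amalgamated element, which also lies in the second factor.
      obtain ⟨a, ha, hax⟩ := mem_base_of_toCoprodI_eq_one φ (x := (inr φ y)⁻¹ * x)
        (by rw [map_mul, map_inv, hx, hy, inv_mul_cancel])
      rw [show a = ((⟨a, ha⟩ : Subgroup.center G₁) : G₁) from rfl, inl_eq_inr] at hax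
      refine ⟨PairFamily.snd G₁ G₂ (y * φ ⟨a, ha⟩), ?_⟩
      rw [PairFamily.lift_snd, map_mul, hax, mul_inv_cancel_left]
    · obtain ⟨y, hy⟩ := exists_inl_of_toCoprodI φ m
      obtain ⟨a, ha, hax⟩ := mem_base_of_toCoprodI_eq_one φ (x := (inl φ y)⁻¹ * x)
        (by rw [map_mul, map_inv, hx, hy, inv_mul_cancel])
      refine ⟨PairFamily.fst G₁ G₂ (y * a), ?_⟩
      rw [PairFamily.lift_fst, map_mul, hax, mul_inv_cancel_left]
  · rintro (_ | _)
    -- The centre of each factor is amalgamated, hence central in the whole group, so no extra 2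
    -- appears.
    · refine Or.inr ⟨(PairFamily.cdim_false G₁ G₂).trans_le (le_max_right _ _), fun a ha => ?_⟩
      refine inr_mem_center φ ⟨(PairFamily.snd G₁ G₂).symm a, ?_⟩
      refine mem_center_iff_commute.2 fun y => ?_
      simpa using (mem_center_iff_commute.1 ha (PairFamily.snd G₁ G₂ y)).map
        (PairFamily.snd G₁ G₂).symm
    · refine Or.inr ⟨(PairFamily.cdim_true G₁ G₂).trans_le (le_max_left _ _), fun a ha => ?_⟩
      refine inl_mem_center φ ⟨(PairFamily.fst G₁ G₂).symm a, ?_⟩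
      refine mem_center_iff_commute.2 fun y => ?_
      simpa using (mem_center_iff_commute.1 ha (PairFamily.fst G₁ G₂ y)).map
        (PairFamily.fst G₁ G₂).symm

end AmalgamatedProduct

theorem proposition3p3 {G₁ G₂ : Type*} [Group G₁] [Group G₂]
    (h₁ : cdim G₁ < ⊤) (h₂ : cdim G₂ < ⊤) :
    (∀ H : Subgroup G₂, cdim H ≤ cdim G₂) ∧
    cdim (G₁ × G₂) = cdim G₁ + cdim G₂ ∧
    (Nontrivial G₁ → Nontrivial G₂ →
      cdim (Monoid.Coprod G₁ G₂) = max (cdim G₁ + zOf G₁) (cdim G₂ + zOf G₂)) ∧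
    ((∃ x y : G₁, x * y ≠ y * x) → (∃ x y : G₂, x * y ≠ y * x) →
      Subgroup.center G₁ ≠ ⊥ →
      ∀ φ : Subgroup.center G₁ ≃* Subgroup.center G₂,
        cdim (AmalgamatedProduct φ) = max (cdim G₁) (cdim G₂)) :=
  ⟨fun H => cdim_le_of_injective H.subtype_injective, cdim_prod h₁ h₂,
    fun _ _ => cdim_coprod, fun h h' _ φ => AmalgamatedProduct.cdim_eq_max φ h h'⟩
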